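/- Let $p\in(0,1)$. For $Z\in\mathbb{R}^{m\times n}$ put $\|Z\|_{\mathcal S_p}^p=\sum_{i=1}^{\min(m,n)}\sigma_i(Z)^p$, where $\sigma_i(Z)$ are the singular values of $Z$, and for $x\in\mathbb{R}^r$ put $\|x\|_p^p=\sum_{i=1}^r|x_i|^p$. For a real-valued function $f$ on a Euclidean space, the regular (Fréchet) subdifferential $\hat\partial f(\bar x)$ is the set of all $v$ with $f(x)\ge f(\bar x)+\langle v,x-\bar x\rangle+o(\|x-\bar x\|)$ as $x\to\bar x$; on $\mathbb{R}^{m\times n}$ the inner product is $\langle A,B\rangle=\operatorname{tr}(A^TB)$. Let $X\in\mathbb{R}^{m\times n}$ have the compact singular value decomposition $X=U\Sigma V^T$, that is, $U\in\mathbb{R}^{m\times r}$ and $V\in\mathbb{R}^{n\times r}$ satisfy $U^TU=V^TV=I_r$, and $\Sigma=\operatorname{diag}(\sigma_+(X))$, where $\sigma_+(X)\in(0,\infty)^r$ is the vector of the positive singular values of $X$. Then the regular subdifferential of $\|\cdot\|_{\mathcal S_p}^p$ at $X$ is $$\hat\partial\|X\|_{\mathcal S_p}^p=\bigl\{\,U\operatorname{diag}(d)V^T+W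 \;:\; d\in\hat\partial\|\sigma_+(X)\|_p^p,\ W\in\mathbb{R}^{m\times n},\ U^TW=0,\ WV=0\,\bigr\},$$ where $\hat\partial\|\sigma_+(X)\|_p^p$ is the regular subdifferential of $\|\cdot\|_p^p$ on $\mathbb{R}^r$ at $\sigma_+(X)$. In particular no bound on the spectral norm of $W$ is required. -/

import Mathlib

open Filter Topology

/-- A vector `v` is a regular (Fréchet) subgradient of `f` at `a` if
`f x ≥ f a + ⟪v, x - a⟫ + o(‖x - a‖)` as `x → a`, that is, if
`liminf_{x → a, x ≠ a} (f x - f a - ⟪v, x - a⟫) / ‖x - a‖ ≥ 0`.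
The regular subdifferential of `f` at `a` is the set of its regular subgradients there. -/
def regularSubdifferential {E : Type*} [NormedAddCommGroup E] [InnerProductSpace ℝ E]
    (f : E → ℝ) (a : E) : Set E :=
  {v | ∀ ε : ℝ, 0 < ε → ∀ᶠ x in 𝓝 a, f a + inner ℝ v (x - a) - ε * ‖x - a‖ ≤ f x}

attribute [local instance] Matrix.frobeniusNormedAddCommGroup

/-- The Frobenius (trace) inner product `⟪A, B⟫ = tr (Aᵀ B)` on real matrices. Its norm is the
Frobenius norm. -/
noncomputable instance frobeniusInnerProductSpace {m n : ℕ} :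
    InnerProductSpace ℝ (Matrix (Fin m) (Fin n) ℝ) where
  toNormedSpace := Matrix.frobeniusNormedSpace
  inner A B := (A.transpose * B).trace
  norm_sq_eq_re_inner A := by
    have h : (0 : ℝ) ≤ ∑ i, ∑ j, ‖A i j‖ ^ (2 : ℝ) := by positivity
    rw [Matrix.frobenius_norm_def, ← Real.sqrt_eq_rpow, Real.sq_sqrt h]
    simp only [Matrix.trace, Matrix.diag, Matrix.mul_apply, Matrix.transpose_apply, map_sum]
    rw [Finset.sum_comm]
    simp [sq]
  conj_inner_symm A B := by
    simp [Matrix.trace, Matrix.mul_apply, mul_comm]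
  add_left A B C := by
    simp [Matrix.transpose_add, Matrix.add_mul, Matrix.trace_add]
  smul_left A B c := by
    simp [Matrix.transpose_smul, Matrix.smul_mul, Matrix.trace_smul]

/-- The Schatten-`p` quasi-norm of `X` raised to the power `p`: `∑ i, σᵢ(X) ^ p`, the sum over the
`min m n` singular values of the `m × n` matrix `X`. -/
noncomputable def schattenPow (p : ℝ) {m n : ℕ} (X : Matrix (Fin m) (Fin n) ℝ) : ℝ :=
  ∑ i ∈ Finset.range (min m n), (Matrix.toEuclideanLin X).singularValues i ^ p

/-- The `ℓ_p` quasi-norm of `x` raised to the power `p`: `∑ i, |xᵢ| ^ p`. -/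
noncomputable def lpPow (p : ℝ) {r : ℕ} (x : EuclideanSpace ℝ (Fin r)) : ℝ :=
  ∑ i, |x i| ^ p

/-- `X = U Σ Vᵀ` is a compact singular value decomposition: `U` and `V` have orthonormal columns
and `Σ = diag σ` with all `σ i > 0`, so that `σ` is the vector of the positive singular values of
`X` (with multiplicity). No ordering of the `σ i` is required. -/
structure IsCompactSVD {m n r : ℕ} (X : Matrix (Fin m) (Fin n) ℝ)
    (U : Matrix (Fin m) (Fin r) ℝ) (σ : EuclideanSpace ℝ (Fin r))
    (V : Matrix (Fin n) (Fin r) ℝ) : Prop where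
  orthonormal_left : U.transpose * U = 1
  orthonormal_right : V.transpose * V = 1
  pos : ∀ i, 0 < σ i
  eq : X = U * Matrix.diagonal (fun i => σ i) * V.transpose

/-! Since every `σ i` is positive, `lpPow p` is differentiable at `σ` and its only regular
subgradient there is `p * σ i ^ (p - 1)`. The claim thus concerns the matrices `Y` with `Y * V = U *
diagonal (p σ ^ (p - 1))` and the transposed identity; `W` is what remains of `Y`.

Necessity. Along a line `X + t • (K * Vᵀ)` the row space stays in the range of `V`, and Jensen's
inequality (`schattenPow_le_of_mul_eq`) bounds the Schatten power by the sum of the `p`-th powers of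
the column norms of `Z * V`. This majorant touches at `t = 0` and is differentiable there, so it
fixes the inner product of `Y` with `K * Vᵀ` (`inner_eq_of_mem_regularSubdifferential`). Varying `K`
gives `Y * V`, and transposing gives `Uᵀ * Y`.

Sufficiency. The symmetric dilation turns singular values into eigenvalues. In an eigenbasis of the
dilation of `X`, the dilation of `Y` is diagonal apart from a block `N` on the kernel. The squared
overlaps with an eigenbasis of the dilation of `Z` are doubly stochastic, so averaging scalar
inequalities yields a global lower bound with quadratic error
(`IsCompactSVD.exists_quadratic_le_schattenPow`). As `p < 1`, `|x| ^ p` has infinite slope at `0`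
and absorbs `N` whatever its size; hence no bound on `W`. -/

/-! ### Two tests for regular subgradients. -/

section Subgradients

variable {E : Type*} [NormedAddCommGroup E] [InnerProductSpace ℝ E]

theorem mem_regularSubdifferential_of_quadratic {f : E → ℝ} {a v : E} (C : ℝ)
    (h : ∀ x, f a + inner ℝ v (x - a) - C * ‖x - a‖ ^ 2 ≤ f x) :
    v ∈ regularSubdifferential f a := by
  intro ε hε
  have h1 : Tendsto (fun x : E => C * ‖x - a‖) (𝓝 a) (𝓝 0) := by
    have : Continuous fun x : E => C * ‖x - a‖ := by fun_prop
    simpa using this.tendsto a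
  filter_upwards [h1.eventually (gt_mem_nhds hε)] with x hx
  have := mul_le_mul_of_nonneg_right hx.le (norm_nonneg (x - a))
  have := h x
  nlinarith

/-- A differentiable majorant touching `f` at `a` along the line leaves no freedom: `t > 0` and `t <
0` give opposite inequalities. Differentiability of `f` itself is not needed. -/
theorem inner_eq_of_mem_regularSubdifferential {f : E → ℝ} {a v h : E} {φ : ℝ → ℝ} {D : ℝ}
    (hv : v ∈ regularSubdifferential f a) (hφ : HasDerivAt φ D 0) (h0 : φ 0 = f a)
    (hle : ∀ t : ℝ, f (a + t • h) ≤ φ t) : inner ℝ v h = D := by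
  -- The error is `ε * ‖h‖` from the subgradient inequality plus `ε` from the derivative of `φ`.
  have key : ∀ ε : ℝ, 0 < ε → |inner ℝ v h - D| ≤ ε * (‖h‖ + 1) := by
    intro ε hε
    have hc : Tendsto (fun t : ℝ => a + t • h) (𝓝 0) (𝓝 a) := by
      have : Continuous fun t : ℝ => a + t • h := by fun_prop
      simpa using this.tendsto 0
    have h1 := hc.eventually (hv ε hε)
    have h2 := (hasDerivAt_iff_isLittleO.1 hφ).def hε
    obtain ⟨δ, hδ, hball⟩ := Metric.eventually_nhds_iff.1 (h1.and h2)
    have step : ∀ t : ℝ, |t| < δ → t * (inner ℝ v h - D) ≤ ε * (‖h‖ + 1) * |t| := by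
      intro t ht
      obtain ⟨h3, h4⟩ := hball (y := t) (by simpa using ht)
      have h5 := hle t
      simp only [add_sub_cancel_left, inner_smul_right, norm_smul, Real.norm_eq_abs] at h3
      simp only [sub_zero, smul_eq_mul, Real.norm_eq_abs] at h4
      have h6 := (abs_le.1 h4).2
      rw [h0] at h6
      nlinarith
    have hp := step (δ / 2) (by rw [abs_of_pos (by positivity)]; linarith)
    have hn := step (-(δ / 2)) (by rw [abs_neg, abs_of_pos (by positivity)]; linarith)
    rw [abs_of_pos (by positivity)] at hp
    rw [abs_neg, abs_of_pos (by positivity)] at hn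
    have hδ2 : 0 < δ / 2 := by positivity
    rw [abs_le]
    constructor
    · by_contra! hlt
      nlinarith
    · by_contra! hlt
      nlinarith
  have hz : |inner ℝ v h - D| ≤ 0 := by
    refine le_of_forall_pos_le_add fun ε hε => ?_
    have hpos : 0 < ‖h‖ + 1 := by positivity
    have := key (ε / (‖h‖ + 1)) (by positivity)
    rwa [div_mul_cancel₀ _ hpos.ne', ← zero_add ε] at this
  exact sub_eq_zero.1 (abs_eq_zero.1 (le_antisymm hz (abs_nonneg _)))

end Subgradients

/-! ### Scalar inequalities for `|x| ^ p` and the subdifferential of `lpPow`. -/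

section Scalar

variable {p : ℝ}

/-- With `s = (1 - p) * (t - 1)` the left side factors as `t * (1 - s)`. For `t > 0`, Bernoulli's
inequality for the exponent `1 - p` gives `t ≤ t ^ p * (1 + s)`, and `(1 - s) * (1 + s) ≤ 1`. For `t
≤ 0` the left side is nonpositive. -/
theorem quadratic_le_abs_rpow_one (hp0 : 0 < p) (hp1 : p < 1) (t : ℝ) :
    1 + p * (t - 1) - (1 - p) * (t - 1) ^ 2 ≤ |t| ^ p := by
  rcases le_or_gt t 0 with ht | ht
  · have : 0 ≤ |t| ^ p := by positivity
    nlinarith [mul_nonneg_of_nonpos_of_nonpos ht (by linarith : p - 1 ≤ 0), sq_nonneg t,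
      mul_nonneg (sub_nonneg.2 hp1.le) (sq_nonneg t), mul_nonneg hp0.le (neg_nonneg.2 ht)]
  · rw [abs_of_pos ht]
    have h1 : t ^ (1 - p) ≤ 1 + (1 - p) * (t - 1) := by
      simpa using rpow_one_add_le_one_add_mul_self (s := t - 1) (by linarith)
        (sub_nonneg.2 hp1.le) (by linarith)
    have h2 : t ^ p * t ^ (1 - p) = t := by
      rw [← Real.rpow_add ht]; simp
    have h3 : 0 < t ^ p := by positivity
    have h4 : 0 < 1 + (1 - p) * (t - 1) := by nlinarith
    have h5 : t ≤ t ^ p * (1 + (1 - p) * (t - 1)) := by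
      calc t = t ^ p * t ^ (1 - p) := h2.symm
        _ ≤ _ := mul_le_mul_of_nonneg_left h1 h3.le
    by_contra! hlt
    have h6 := mul_lt_mul_of_pos_right hlt h4
    have h7 : (1 + p * (t - 1) - (1 - p) * (t - 1) ^ 2) = t * (1 - (1 - p) * (t - 1)) := by ring
    rw [h7] at h6
    nlinarith [mul_nonneg ht.le (sq_nonneg ((1 - p) * (t - 1)))]

theorem exists_quadratic_le_abs_rpow (hp0 : 0 < p) (hp1 : p < 1) {μ : ℝ} (hμ : μ ≠ 0) :
    ∃ C, 0 ≤ C ∧ ∀ x : ℝ,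
      |μ| ^ p + p * |μ| ^ (p - 2) * μ * (x - μ) - C * (x - μ) ^ 2 ≤ |x| ^ p := by
  have hpos : 0 < |μ| := abs_pos.2 hμ
  refine ⟨(1 - p) * |μ| ^ (p - 2), mul_nonneg (by linarith) (by positivity), fun x => ?_⟩
  -- Homogeneity reduces to the base point `1`, also for negative `μ`.
  have h := mul_le_mul_of_nonneg_left (quadratic_le_abs_rpow_one hp0 hp1 (x / μ))
    (by positivity : 0 ≤ |μ| ^ p)
  rw [abs_div, Real.div_rpow (abs_nonneg _) (abs_nonneg _),
    mul_div_cancel₀ _ (by positivity : |μ| ^ p ≠ 0)] at h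
  have h2 : |μ| ^ p = |μ| ^ (p - 2) * μ ^ 2 := by
    rw [← sq_abs μ, ← Real.rpow_natCast |μ| 2, ← Real.rpow_add hpos]; simp
  refine le_trans (le_of_eq ?_) h
  rw [h2]
  field_simp

theorem exists_linear_sub_quadratic_le_rpow (hp1 : p < 1) {w : ℝ} (hw : 0 < w) :
    ∃ C, 0 ≤ C ∧ ∀ x : ℝ, w * |x| - C * x ^ 2 ≤ |x| ^ p := by
  -- `δ` is the positive solution of `w * δ = δ ^ p`: below it the power beats the line, above it
  -- the quadratic term does.
  set δ : ℝ := (w⁻¹) ^ (1 - p)⁻¹ with hδ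
  have hδ0 : 0 < δ := by positivity
  refine ⟨w / δ, by positivity, fun x => ?_⟩
  rcases eq_or_ne x 0 with rfl | hx
  · simp only [abs_zero]
    have : (0 : ℝ) ≤ 0 ^ p := Real.rpow_nonneg le_rfl _
    simpa using this
  have hx0 : 0 < |x| := abs_pos.2 hx
  rcases le_or_gt |x| δ with hle | hgt
  · have h1 : |x| ^ (1 - p) ≤ w⁻¹ := by
      calc |x| ^ (1 - p) ≤ δ ^ (1 - p) :=
            Real.rpow_le_rpow hx0.le hle (by linarith)
        _ = w⁻¹ := by
            rw [hδ, ← Real.rpow_mul (by positivity), inv_mul_cancel₀ (by linarith), Real.rpow_one]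
    have h2 : |x| ^ p * |x| ^ (1 - p) = |x| := by
      rw [← Real.rpow_add hx0]; simp
    have h3 : 0 ≤ |x| ^ p := by positivity
    have h4 : |x| ≤ |x| ^ p * w⁻¹ := by
      calc |x| = |x| ^ p * |x| ^ (1 - p) := h2.symm
        _ ≤ _ := mul_le_mul_of_nonneg_left h1 h3
    have h5 : w * |x| ≤ |x| ^ p := by
      rw [← div_eq_mul_inv, le_div_iff₀ hw] at h4; linarith
    have : 0 ≤ w / δ * x ^ 2 := by positivity
    linarith
  · have h3 : 0 ≤ |x| ^ p := by positivity
    have h4 : w * |x| ≤ w / δ * x ^ 2 := by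
      rw [← sq_abs, div_mul_eq_mul_div, le_div_iff₀ hδ0]
      nlinarith [mul_pos hw hx0]
    linarith

/-- At `μ = 0` the formal derivative `p * |μ| ^ (p - 2) * μ` evaluates to `0` through its last
factor, and a slope `w` of any size is available there. This is the room that absorbs `W`. -/
theorem exists_quadratic_add_le_abs_rpow (hp0 : 0 < p) (hp1 : p < 1) (μ w : ℝ) :
    ∃ C, 0 ≤ C ∧ ∀ x : ℝ, |μ| ^ p + p * |μ| ^ (p - 2) * μ * (x - μ) +
      (if μ = 0 then w * |x| else 0) - C * (x - μ) ^ 2 ≤ |x| ^ p := by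
  by_cases hμ : μ = 0
  · obtain ⟨C, hC, h⟩ := exists_linear_sub_quadratic_le_rpow hp1
      (show 0 < |w| + 1 by positivity)
    refine ⟨C, hC, fun x => ?_⟩
    have h1 := h x
    have h2 : w * |x| ≤ (|w| + 1) * |x| :=
      mul_le_mul_of_nonneg_right (by linarith [le_abs_self w]) (abs_nonneg x)
    simp only [hμ, abs_zero, Real.zero_rpow hp0.ne', if_true, sub_zero, mul_zero, zero_mul]
    linarith
  · obtain ⟨C, hC, h⟩ := exists_quadratic_le_abs_rpow hp0 hp1 hμ
    exact ⟨C, hC, fun x => by simpa [hμ] using h x⟩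

theorem mem_regularSubdifferential_lpPow_iff {r : ℕ} (hp0 : 0 < p) (hp1 : p < 1)
    {σ : EuclideanSpace ℝ (Fin r)} (hσ : ∀ i, 0 < σ i) (d : EuclideanSpace ℝ (Fin r)) :
    d ∈ regularSubdifferential (lpPow p) σ ↔ ∀ i, d i = p * σ i ^ (p - 1) := by
  constructor
  · intro hd i
    have hderiv : HasDerivAt (fun t : ℝ => lpPow p (σ + t • EuclideanSpace.single i (1 : ℝ)))
        (p * σ i ^ (p - 1)) 0 := by
      have h : ∀ j ∈ Finset.univ, HasDerivAt
          (fun t : ℝ => |(σ + t • EuclideanSpace.single i (1 : ℝ)) j| ^ p)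
          (if j = i then p * σ i ^ (p - 1) else 0) 0 := by
        intro j _
        by_cases hj : j = i
        · subst hj
          have h1 : HasDerivAt (fun t : ℝ => (σ j + t) ^ p) (p * σ j ^ (p - 1)) 0 := by
            have := ((hasDerivAt_id (0 : ℝ)).const_add (σ j)).rpow_const (p := p)
              (Or.inl (by simpa using (hσ j).ne'))
            simpa using this
          rw [if_pos rfl]
          refine h1.congr_of_eventuallyEq ?_
          have hev : ∀ᶠ t : ℝ in 𝓝 0, 0 < σ j + t := by
            have : Continuous fun t : ℝ => σ j + t := by fun_prop
            exact this.continuousAt.eventually (lt_mem_nhds (by simpa using hσ j))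
          filter_upwards [hev] with t ht
          simp [abs_of_pos ht]
        · rw [if_neg hj]
          simpa [hj] using hasDerivAt_const (0 : ℝ) (|σ j| ^ p)
      have := HasDerivAt.fun_sum h
      simpa [lpPow] using this
    have := inner_eq_of_mem_regularSubdifferential hd hderiv (by simp) (fun t => le_rfl)
    simpa [EuclideanSpace.inner_single_right] using this
  · intro hd
    choose C hC hle using fun i => exists_quadratic_le_abs_rpow hp0 hp1 (hσ i).ne'
    refine mem_regularSubdifferential_of_quadratic (∑ i, C i) fun x => ?_
    have h1 : ∀ i, |σ i| ^ p + d i * (x i - σ i) - (∑ i, C i) * (x i - σ i) ^ 2 ≤ |x i| ^ p := by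
      intro i
      have h2 := hle i (x i)
      have h3 : C i ≤ ∑ i, C i := Finset.single_le_sum (fun j _ => hC j) (Finset.mem_univ i)
      have h4 : p * |σ i| ^ (p - 2) * σ i = d i := by
        rw [hd i, abs_of_pos (hσ i), mul_assoc, ← Real.rpow_add_one (hσ i).ne']
        congr 2; ring
      rw [h4] at h2
      have := mul_le_mul_of_nonneg_right h3 (sq_nonneg (x i - σ i))
      linarith
    have h2 := Finset.sum_le_sum fun i (_ : i ∈ Finset.univ) => h1 i
    rw [EuclideanSpace.real_norm_sq_eq]
    simp only [lpPow, PiLp.inner_apply, PiLp.sub_apply, Finset.mul_sum]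
    simp only [Finset.sum_sub_distrib, Finset.sum_add_distrib] at h2
    refine le_trans (le_of_eq ?_) h2
    simp [mul_comm]

end Scalar

/-! ### Singular values through Gram matrices and the symmetric dilation. -/

section Spectral

open Matrix

/-- Double counting: `t` couples only equal values, and zero values cost nothing because `F 0 = 0`.
It compares two spectra with multiplicity without matching their indices. -/
theorem sum_comp_eq_of_weights {ι κ : Type*} [Fintype ι] [Fintype κ] (t : ι → κ → ℝ)
    {a : ι → ℝ} {b : κ → ℝ} {F : ℝ → ℝ} (hF : F 0 = 0) {α β : ℝ}
    (ht : ∀ i k, t i k ≠ 0 → a i = b k) (hα : ∀ i, a i ≠ 0 → ∑ k, t i k = α)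
    (hβ : ∀ k, b k ≠ 0 → ∑ i, t i k = β) :
    α * ∑ i, F (a i) = β * ∑ k, F (b k) := by
  have h1 : ∀ i, α * F (a i) = ∑ k, t i k * F (a i) := by
    intro i
    by_cases h : a i = 0
    · simp [h, hF]
    · rw [← Finset.sum_mul, hα i h]
  have h2 : ∀ k, β * F (b k) = ∑ i, t i k * F (b k) := by
    intro k
    by_cases h : b k = 0
    · simp [h, hF]
    · rw [← Finset.sum_mul, hβ k h]
  rw [Finset.mul_sum, Finset.mul_sum, Finset.sum_congr rfl fun i _ => h1 i,
    Finset.sum_congr rfl fun k _ => h2 k, Finset.sum_comm]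
  refine Finset.sum_congr rfl fun k _ => Finset.sum_congr rfl fun i _ => ?_
  by_cases h : t i k = 0
  · simp [h]
  · rw [ht i k h]

/-- `Q` is orthogonal and its columns are eigenvectors of `A` with eigenvalues `l`. -/
structure IsEigenbasis {ι : Type*} [Fintype ι] [DecidableEq ι] (A Q : Matrix ι ι ℝ)
    (l : ι → ℝ) : Prop where
  transpose_mul_self : Qᵀ * Q = 1
  mul_eq : A * Q = Q * diagonal l

namespace IsEigenbasis

variable {ι : Type*} [Fintype ι] [DecidableEq ι] {A Q : Matrix ι ι ℝ} {l : ι → ℝ}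

theorem mul_transpose_self (h : IsEigenbasis A Q l) : Q * Qᵀ = 1 :=
  mul_eq_one_comm.1 h.transpose_mul_self

theorem eq_mul (h : IsEigenbasis A Q l) : A = Q * diagonal l * Qᵀ := by
  rw [← h.mul_eq, Matrix.mul_assoc, h.mul_transpose_self, Matrix.mul_one]

theorem mulVec_col (h : IsEigenbasis A Q l) (k : ι) : A *ᵥ Q.col k = l k • Q.col k := by
  ext i
  have := congrFun (congrFun h.mul_eq i) k
  rw [mul_diagonal, mul_apply] at this
  simpa [mulVec, dotProduct, mul_comm] using this

end IsEigenbasis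

theorem exists_isEigenbasis {ι : Type*} [Fintype ι] [DecidableEq ι] {A : Matrix ι ι ℝ}
    (hA : Aᵀ = A) : ∃ Q l, IsEigenbasis A Q l := by
  have hH : A.IsHermitian := by rw [IsHermitian, conjTranspose_eq_transpose_of_trivial, hA]
  refine ⟨hH.eigenvectorUnitary, hH.eigenvalues, ?_, ?_⟩
  · have := (mem_unitaryGroup_iff').1 hH.eigenvectorUnitary.2
    rwa [star_eq_conjTranspose, conjTranspose_eq_transpose_of_trivial] at this
  · ext i k
    rw [mul_diagonal]
    have := congrFun (hH.mulVec_eigenvectorBasis k) i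
    simp only [mulVec, dotProduct, Pi.smul_apply, smul_eq_mul] at this
    simp only [mul_apply, IsHermitian.eigenvectorUnitary_apply]
    rw [this, mul_comm]

variable {m n r : ℕ}

theorem exists_isEigenbasis_gram (Z : Matrix (Fin m) (Fin n) ℝ) :
    ∃ Q b, IsEigenbasis (Zᵀ * Z) Q b ∧ (∀ l, 0 ≤ b l) ∧
      ∀ p : ℝ, 0 < p → schattenPow p Z = ∑ l, b l ^ (p / 2) := by
  set T := toEuclideanLin Z with hT
  have hn : Module.finrank ℝ (EuclideanSpace ℝ (Fin n)) = n := finrank_euclideanSpace_fin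
  set hS := T.isSymmetric_adjoint_comp_self
  set B := hS.eigenvectorBasis hn with hB
  have hcomp : T.adjoint ∘ₗ T = toEuclideanLin (Zᵀ * Z) := by
    rw [hT, ← toEuclideanLin_conjTranspose_eq_adjoint, conjTranspose_eq_transpose_of_trivial]
    ext v i
    simp [toLpLin_apply]
  refine ⟨of fun i l => B l i, hS.eigenvalues hn, ⟨?_, ?_⟩, ?_, ?_⟩
  · ext l l'
    have := orthonormal_iff_ite.1 B.orthonormal l l'
    simp only [PiLp.inner_apply, RCLike.inner_apply, conj_trivial] at this
    simp only [mul_apply, transpose_apply, of_apply, one_apply]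
    rw [← this]
    exact Finset.sum_congr rfl fun i _ => mul_comm _ _
  · ext i l
    have := congrArg (fun v : EuclideanSpace ℝ (Fin n) => v i) 
      ((LinearMap.congr_fun hcomp (B l)).symm.trans (hS.apply_eigenvectorBasis hn l))
    rw [mul_diagonal, mul_apply]
    simpa [toLpLin_apply, mulVec, dotProduct, mul_comm, hB] using this
  · exact T.isPositive_adjoint_comp_self.nonneg_eigenvalues hn
  · intro p hp
    -- The Gram matrix has `n` eigenvalues; the indices beyond `min m n` contribute `0 ^ p = 0`, as
    -- `p > 0`.
    have h1 : schattenPow p Z = ∑ i ∈ Finset.range n, T.singularValues i ^ p := by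
      refine Finset.sum_subset (Finset.range_mono (min_le_right m n)) fun i hi hi' => ?_
      have hrank : Module.finrank ℝ (LinearMap.range T) ≤ i := by
        have h2 : Module.finrank ℝ (LinearMap.range T) ≤ m := by
          simpa using Submodule.finrank_le (LinearMap.range T)
        simp only [Finset.mem_range] at hi hi'
        omega
      rw [T.singularValues_eq_zero_iff_le_finrank_range.2 hrank, Real.zero_rpow hp.ne']
    rw [h1, Finset.sum_range]
    refine Finset.sum_congr rfl fun i _ => ?_
    rw [T.singularValues_fin hn, Real.sqrt_eq_rpow, ← Real.rpow_mul
      (T.isPositive_adjoint_comp_self.nonneg_eigenvalues hn i)]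
    congr 1; ring

/-- The symmetric dilation of a rectangular matrix. -/
def symmDilation (Z : Matrix (Fin m) (Fin n) ℝ) : Matrix (Fin m ⊕ Fin n) (Fin m ⊕ Fin n) ℝ :=
  fromBlocks 0 Z Zᵀ 0

theorem transpose_symmDilation (Z : Matrix (Fin m) (Fin n) ℝ) :
    (symmDilation Z)ᵀ = symmDilation Z := by
  simp [symmDilation, fromBlocks_transpose]

theorem symmDilation_sub (Z Y : Matrix (Fin m) (Fin n) ℝ) :
    symmDilation (Z - Y) = symmDilation Z - symmDilation Y := by
  ext (i | i) (j | j) <;> simp [symmDilation]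

theorem trace_symmDilation_mul (Y Z : Matrix (Fin m) (Fin n) ℝ) :
    (symmDilation Y * symmDilation Z).trace = 2 * (Yᵀ * Z).trace := by
  rw [symmDilation, symmDilation, fromBlocks_multiply, trace, Fintype.sum_sum_type]
  simp only [diag_apply, fromBlocks_apply₁₁, fromBlocks_apply₂₂, zero_add, add_zero,
    Matrix.mul_zero]
  change (Y * Zᵀ).trace + (Yᵀ * Z).trace = _
  rw [← trace_transpose (Y * Zᵀ), transpose_mul, transpose_transpose, trace_mul_comm Z]
  ring

theorem symmDilation_mulVec_eq_iff {Z : Matrix (Fin m) (Fin n) ℝ} {v : Fin m ⊕ Fin n → ℝ}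
    {c : ℝ} : symmDilation Z *ᵥ v = c • v ↔
      Z *ᵥ (v ∘ Sum.inr) = c • (v ∘ Sum.inl) ∧ Zᵀ *ᵥ (v ∘ Sum.inl) = c • (v ∘ Sum.inr) := by
  rw [symmDilation, fromBlocks_mulVec]
  simp only [zero_mulVec, zero_add, add_zero]
  constructor
  · intro h
    rw [← Sum.elim_comp_inl_inr (c • v), Sum.elim_eq_iff] at h
    exact h
  · rintro ⟨h1, h2⟩
    rw [h1, h2]
    ext (i | i) <;> simp

/-- An eigenvector `(x, y)` of the dilation for `l k ≠ 0` has both halves of squared norm `1 / 2`,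
and `y` is an eigenvector of `Zᵀ * Z` for `l k ^ 2`. The coupling weights `(y k ⬝ᵥ Q.col i) ^ 2`
therefore have total `1 / 2` over `i` and `1` over `k`. -/
theorem IsEigenbasis.two_mul_schattenPow {Z : Matrix (Fin m) (Fin n) ℝ}
    {E : Matrix (Fin m ⊕ Fin n) (Fin m ⊕ Fin n) ℝ} {l : Fin m ⊕ Fin n → ℝ}
    (h : IsEigenbasis (symmDilation Z) E l) {p : ℝ} (hp : 0 < p) :
    2 * schattenPow p Z = ∑ k, |l k| ^ p := by
  obtain ⟨Q, b, hQ, hb, hs⟩ := exists_isEigenbasis_gram Z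
  set y : Fin m ⊕ Fin n → Fin n → ℝ := fun k => E.col k ∘ Sum.inr with hy
  set x : Fin m ⊕ Fin n → Fin m → ℝ := fun k => E.col k ∘ Sum.inl with hx
  have hpair : ∀ k, Z *ᵥ y k = l k • x k ∧ Zᵀ *ᵥ x k = l k • y k := fun k =>
    symmDilation_mulVec_eq_iff.1 (h.mulVec_col k)
  have hnorm : ∀ k, x k ⬝ᵥ x k + y k ⬝ᵥ y k = 1 := by
    intro k
    have := congrFun (congrFun h.transpose_mul_self k) k
    rw [mul_apply, one_apply_eq, Fintype.sum_sum_type] at this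
    simpa [dotProduct, hx, hy] using this
  have hhalf : ∀ k, l k ≠ 0 → y k ⬝ᵥ y k = 1 / 2 := by
    intro k hk
    have h1 : x k ⬝ᵥ (Z *ᵥ y k) = (Zᵀ *ᵥ x k) ⬝ᵥ y k := by
      rw [dotProduct_mulVec, mulVec_transpose]
    rw [(hpair k).1, (hpair k).2, dotProduct_smul, smul_dotProduct, smul_eq_mul, smul_eq_mul] at h1
    have := mul_left_cancel₀ hk h1
    linarith [hnorm k]
  have key := sum_comp_eq_of_weights (fun k i => (y k ⬝ᵥ Q.col i) ^ 2) (a := fun k => l k ^ 2)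
    (b := b) (F := fun u => u ^ (p / 2)) (Real.zero_rpow (by positivity)) (α := 1 / 2) (β := 1)
    ?_ ?_ ?_
  · rw [hs p hp]
    have h2 : ∀ k, (l k ^ 2) ^ (p / 2) = |l k| ^ p := by
      intro k
      rw [← sq_abs, ← Real.rpow_natCast, ← Real.rpow_mul (abs_nonneg _)]
      congr 1
      push_cast
      ring
    simp only [h2] at key
    linarith
  · intro k i hne
    have hne' : y k ⬝ᵥ Q.col i ≠ 0 := fun h0 => hne (by simp [h0])
    have h1 : (Zᵀ * Z) *ᵥ y k = l k ^ 2 • y k := by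
      rw [← mulVec_mulVec, (hpair k).1, mulVec_smul, (hpair k).2, smul_smul, sq]
    have h2 := hQ.mulVec_col i
    have h3 : y k ⬝ᵥ ((Zᵀ * Z) *ᵥ Q.col i) = ((Zᵀ * Z) *ᵥ y k) ⬝ᵥ Q.col i := by
      rw [dotProduct_mulVec, ← mulVec_transpose, transpose_mul, transpose_transpose]
    rw [h1, h2, dotProduct_smul, smul_dotProduct, smul_eq_mul, smul_eq_mul] at h3
    exact (mul_right_cancel₀ hne' h3).symm
  · intro k hk
    have hk' : l k ≠ 0 := fun h0 => hk (by simp [h0])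
    rw [← hhalf k hk']
    have h1 : y k ⬝ᵥ ((Q * Qᵀ) *ᵥ y k) = y k ⬝ᵥ y k := by
      rw [hQ.mul_transpose_self, one_mulVec]
    rw [← h1, ← mulVec_mulVec, dotProduct_mulVec]
    simp only [dotProduct, vecMul, mulVec, sq, transpose_apply, col_apply]
    exact Finset.sum_congr rfl fun i _ => by simp only [mul_comm]
  · intro i _
    have h1 : ∀ k, y k ⬝ᵥ Q.col i = (Eᵀ *ᵥ Sum.elim 0 (Q.col i)) k := by
      intro k
      simp [mulVec, dotProduct, Fintype.sum_sum_type, hy]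
    simp only [h1]
    -- The overlaps are the coordinates of the unit vector `(0, Q.col i)` in the orthonormal basis
    -- `E`.
    have h2 : (Eᵀ *ᵥ Sum.elim 0 (Q.col i)) ⬝ᵥ (Eᵀ *ᵥ Sum.elim 0 (Q.col i)) = 1 := by
      rw [dotProduct_mulVec, ← mulVec_transpose, transpose_transpose, mulVec_mulVec,
        h.mul_transpose_self, one_mulVec]
      have := congrFun (congrFun hQ.transpose_mul_self i) i
      rw [mul_apply, one_apply_eq] at this
      simpa [dotProduct, Fintype.sum_sum_type] using this
    simpa [dotProduct, sq] using h2

/-- Swapping the two blocks of the index set turns one dilation into the other. -/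
theorem schattenPow_transpose {p : ℝ} (hp : 0 < p) (Z : Matrix (Fin m) (Fin n) ℝ) :
    schattenPow p Zᵀ = schattenPow p Z := by
  obtain ⟨E, l, hE⟩ := exists_isEigenbasis (transpose_symmDilation Z)
  have hE' : IsEigenbasis (symmDilation Zᵀ)
      (E.submatrix (Equiv.sumComm _ _) (Equiv.sumComm _ _)) (l ∘ Equiv.sumComm _ _) := by
    have hs : symmDilation Zᵀ =
        (symmDilation Z).submatrix (Equiv.sumComm _ _) (Equiv.sumComm _ _) := by
      ext (i | i) (j | j) <;> simp [symmDilation]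
    constructor
    · rw [transpose_submatrix, submatrix_mul_equiv, hE.transpose_mul_self, submatrix_one_equiv]
    · rw [hs, submatrix_mul_equiv, hE.mul_eq, ← submatrix_diagonal_equiv, submatrix_mul_equiv]
  have h1 := hE.two_mul_schattenPow hp
  have h2 := hE'.two_mul_schattenPow hp
  have h3 : ∑ k, |(l ∘ Equiv.sumComm (Fin n) (Fin m)) k| ^ p = ∑ k, |l k| ^ p :=
    Equiv.sum_comp (Equiv.sumComm (Fin n) (Fin m)) fun k => |l k| ^ p
  linarith

/-- Jensen's inequality for the eigenvalues of the Gram matrix. -/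
theorem schattenPow_le_of_mul_eq {p : ℝ} (hp0 : 0 < p) (hp1 : p < 1)
    {Z : Matrix (Fin m) (Fin n) ℝ} {V : Matrix (Fin n) (Fin r) ℝ} (hV : Vᵀ * V = 1)
    (hZ : Z * V * Vᵀ = Z) :
    schattenPow p Z ≤ ∑ i, ((Z * V)ᵀ * (Z * V)) i i ^ (p / 2) := by
  obtain ⟨Q, b, hQ, hb, hs⟩ := exists_isEigenbasis_gram Z
  set R := Qᵀ * V with hR
  have hrow : ∀ i, ∑ l, R l i ^ 2 = 1 := by
    intro i
    have h1 : Rᵀ * R = 1 := by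
      rw [hR, transpose_mul, transpose_transpose, Matrix.mul_assoc, ← Matrix.mul_assoc Q,
        hQ.mul_transpose_self, Matrix.one_mul, hV]
    have := congrFun (congrFun h1 i) i
    simpa [mul_apply, sq] using this
  -- By `hZ`, eigenvectors of `Zᵀ * Z` with nonzero eigenvalue lie in the range of `V`, so
  -- projecting onto it preserves their norm.
  have hcol : ∀ l, b l ≠ 0 → ∑ i, R l i ^ 2 = 1 := by
    intro l hl
    have h1 : diagonal b * (R * Rᵀ) = diagonal b := by
      have h2 : Qᵀ * (Zᵀ * Z) = diagonal b * Qᵀ := by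
        rw [hQ.eq_mul, ← Matrix.mul_assoc, ← Matrix.mul_assoc, hQ.transpose_mul_self,
          Matrix.one_mul]
      have h3 : Zᵀ * Z * (V * Vᵀ) = Zᵀ * Z := by
        rw [Matrix.mul_assoc, ← Matrix.mul_assoc Z, hZ]
      calc diagonal b * (R * Rᵀ) = diagonal b * Qᵀ * (V * Vᵀ) * Q := by
            rw [hR, transpose_mul, transpose_transpose]
            simp only [Matrix.mul_assoc]
        _ = Qᵀ * (Zᵀ * Z) * Q := by rw [← h2, Matrix.mul_assoc Qᵀ, h3]
        _ = diagonal b := by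
            rw [h2, Matrix.mul_assoc, hQ.transpose_mul_self, Matrix.mul_one]
    have := congrFun (congrFun h1 l) l
    rw [diagonal_mul, diagonal_apply_eq] at this
    have h4 := mul_left_cancel₀ hl (this.trans (mul_one _).symm)
    simpa [mul_apply, sq] using h4
  have hgram : ∀ i, ((Z * V)ᵀ * (Z * V)) i i = ∑ l, R l i ^ 2 * b l := by
    intro i
    have h1 : (Z * V)ᵀ * (Z * V) = Rᵀ * (diagonal b * R) := by
      rw [transpose_mul, Matrix.mul_assoc, ← Matrix.mul_assoc Zᵀ, hQ.eq_mul, hR, transpose_mul,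
        transpose_transpose]
      simp only [Matrix.mul_assoc]
    rw [h1, mul_apply]
    refine Finset.sum_congr rfl fun l _ => ?_
    rw [diagonal_mul, transpose_apply]
    ring
  have hjensen : ∀ i, ∑ l, R l i ^ 2 * b l ^ (p / 2) ≤ ((Z * V)ᵀ * (Z * V)) i i ^ (p / 2) := by
    intro i
    rw [hgram i]
    have := (Real.concaveOn_rpow (p := p / 2) (by linarith) (by linarith)).le_map_sum
      (t := Finset.univ) (w := fun l => R l i ^ 2) (p := b) (fun l _ => sq_nonneg _) (hrow i)
      (fun l _ => hb l)
    simpa using this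
  rw [hs p hp0]
  refine le_trans (le_of_eq ?_) (Finset.sum_le_sum fun i _ => hjensen i)
  rw [Finset.sum_comm]
  refine Finset.sum_congr rfl fun l _ => ?_
  rw [← Finset.sum_mul]
  by_cases hl : b l = 0
  · rw [hl, Real.zero_rpow (by positivity), mul_zero]
  · rw [hcol l hl, one_mul]

end Spectral

/-! ### The Schatten power read off from a compact SVD. -/

namespace IsCompactSVD

open Matrix

variable {m n r : ℕ} {X : Matrix (Fin m) (Fin n) ℝ} {U : Matrix (Fin m) (Fin r) ℝ}
  {σ : EuclideanSpace ℝ (Fin r)} {V : Matrix (Fin n) (Fin r) ℝ}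

theorem transpose (h : IsCompactSVD X U σ V) : IsCompactSVD Xᵀ V σ U where
  orthonormal_left := h.orthonormal_right
  orthonormal_right := h.orthonormal_left
  pos := h.pos
  eq := by rw [h.eq]; simp [Matrix.mul_assoc]

theorem mul_right (h : IsCompactSVD X U σ V) : X * V = U * diagonal (fun i => σ i) := by
  rw [h.eq, Matrix.mul_assoc, h.orthonormal_right, Matrix.mul_one]

theorem schattenPow_eq (h : IsCompactSVD X U σ V) {p : ℝ} (hp : 0 < p) :
    schattenPow p X = ∑ i, σ i ^ p := by
  obtain ⟨Q, b, hQ, hb, hs⟩ := exists_isEigenbasis_gram X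
  have hXX : Xᵀ * X = V * diagonal (fun i => σ i ^ 2) * Vᵀ := by
    have h1 : Xᵀ * U = V * diagonal (fun i => σ i) := h.transpose.mul_right
    nth_rewrite 2 [h.eq]
    rw [← Matrix.mul_assoc, ← Matrix.mul_assoc, h1, Matrix.mul_assoc V, diagonal_mul_diagonal]
    simp only [sq]
  set R := Qᵀ * V with hR
  have hsum : ∀ i, ∑ l, R l i ^ 2 = 1 := by
    intro i
    have h1 : Rᵀ * R = 1 := by
      rw [hR, transpose_mul, transpose_transpose, Matrix.mul_assoc, ← Matrix.mul_assoc Q,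
        hQ.mul_transpose_self, Matrix.one_mul, h.orthonormal_right]
    have := congrFun (congrFun h1 i) i
    simpa [mul_apply, sq] using this
  -- The overlap matrix intertwines the two spectra, so its nonzero entries couple only equal
  -- values.
  have hbR : diagonal b * R = R * diagonal (fun i => σ i ^ 2) := by
    have h2 : Qᵀ * (Xᵀ * X) = diagonal b * Qᵀ := by
      rw [hQ.eq_mul, ← Matrix.mul_assoc, ← Matrix.mul_assoc, hQ.transpose_mul_self, Matrix.one_mul]
    rw [hR, ← Matrix.mul_assoc, ← h2, hXX]
    simp only [Matrix.mul_assoc, h.orthonormal_right, Matrix.mul_one]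
  have hent : ∀ l i, b l * R l i = R l i * σ i ^ 2 := by
    intro l i
    have := congrFun (congrFun hbR l) i
    rwa [diagonal_mul, mul_diagonal] at this
  have hcol : ∀ l, b l ≠ 0 → ∑ i, R l i ^ 2 = 1 := by
    intro l hl
    have h1 : diagonal b * (R * Rᵀ) = diagonal b := by
      calc diagonal b * (R * Rᵀ) = Qᵀ * (V * diagonal (fun i => σ i ^ 2) * Vᵀ) * Q := by
            rw [← Matrix.mul_assoc, hbR, hR, transpose_mul, transpose_transpose]
            simp only [Matrix.mul_assoc]
        _ = diagonal b := by
            rw [← hXX, Matrix.mul_assoc, hQ.mul_eq, ← Matrix.mul_assoc, hQ.transpose_mul_self,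
              Matrix.one_mul]
    have := congrFun (congrFun h1 l) l
    rw [diagonal_mul, diagonal_apply_eq] at this
    have h4 := mul_left_cancel₀ hl (this.trans (mul_one _).symm)
    simpa [mul_apply, sq] using h4
  have key := sum_comp_eq_of_weights (fun l i => R l i ^ 2) (a := b) (b := fun i => σ i ^ 2)
    (F := fun u => u ^ (p / 2)) (Real.zero_rpow (by positivity)) (α := 1) (β := 1)
    (fun l i hne => ?_) hcol (fun i _ => hsum i)
  · rw [hs p hp]
    rw [one_mul, one_mul] at key
    rw [key]
    refine Finset.sum_congr rfl fun i _ => ?_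
    rw [← Real.rpow_natCast, ← Real.rpow_mul (h.pos i).le]
    congr 1
    push_cast
    ring
  · have hne' : R l i ≠ 0 := fun h0 => hne (by simp [h0])
    have := hent l i
    rw [mul_comm] at this
    exact mul_left_cancel₀ hne' this

end IsCompactSVD

/-! ### The quadratic lower bound, for sufficiency. -/

section LowerBound

open Matrix

theorem abs_dotProduct_mulVec_le {ι : Type*} [Fintype ι] {N : Matrix ι ι ℝ} {μ : ι → ℝ}
    (hN : ∀ i j, N i j ≠ 0 → μ i = 0 ∧ μ j = 0) (x : ι → ℝ) :
    |x ⬝ᵥ (N *ᵥ x)| ≤ (∑ i, ∑ j, |N i j|) * ∑ i, if μ i = 0 then x i ^ 2 else 0 := by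
  set S := ∑ i, if μ i = 0 then x i ^ 2 else 0 with hS
  have hle : ∀ i, μ i = 0 → x i ^ 2 ≤ S := by
    intro i hi
    have := Finset.single_le_sum (f := fun i => if μ i = 0 then x i ^ 2 else 0)
      (fun j _ => by split_ifs <;> positivity) (Finset.mem_univ i)
    simpa [hi] using this
  simp only [dotProduct, mulVec, Finset.mul_sum, Finset.sum_mul]
  refine (Finset.abs_sum_le_sum_abs _ _).trans (Finset.sum_le_sum fun i _ => ?_)
  refine (Finset.abs_sum_le_sum_abs _ _).trans (Finset.sum_le_sum fun j _ => ?_)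
  by_cases h : N i j = 0
  · simp [h]
  · obtain ⟨hi, hj⟩ := hN i j h
    have h1 : |x i * x j| ≤ S := by
      rw [abs_le]
      constructor <;> nlinarith [hle i hi, hle j hj, sq_nonneg (x i + x j), sq_nonneg (x i - x j)]
    calc |x i * (N i j * x j)| = |N i j| * |x i * x j| := by
          rw [← abs_mul]; congr 1; ring
      _ ≤ |N i j| * S := mul_le_mul_of_nonneg_left h1 (abs_nonneg _)

variable {m n r : ℕ} {X W : Matrix (Fin m) (Fin n) ℝ} {U : Matrix (Fin m) (Fin r) ℝ}
  {σ : EuclideanSpace ℝ (Fin r)} {V : Matrix (Fin n) (Fin r) ℝ}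

/-- On a singular pair with `c ≠ 0`, `b` lies in the range of `V`, so `W` kills it, and only the
coordinates with `σ j = |c|` survive. Negative `c` is allowed because the dilation also has the
eigenvalues `-σ j`. -/
theorem IsCompactSVD.mulVec_of_singular_pair (h : IsCompactSVD X U σ V) (p : ℝ)
    (hWV : W * V = 0) {a : Fin m → ℝ} {b : Fin n → ℝ} {c : ℝ} (hc : c ≠ 0)
    (h1 : X *ᵥ b = c • a) (h2 : Xᵀ *ᵥ a = c • b) :
    (U * diagonal (fun i => p * σ i ^ (p - 1)) * Vᵀ + W) *ᵥ b = (p * |c| ^ (p - 2) * c) • a := by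
  have hUX : Uᵀ * X = diagonal (fun i => σ i) * Vᵀ := by
    rw [h.eq, ← Matrix.mul_assoc, ← Matrix.mul_assoc, h.orthonormal_left, Matrix.one_mul]
  have hVX : Vᵀ * Xᵀ = diagonal (fun i => σ i) * Uᵀ := by
    rw [h.transpose.eq, ← Matrix.mul_assoc, ← Matrix.mul_assoc, h.orthonormal_right,
      Matrix.one_mul]
  have hW : W *ᵥ b = 0 := by
    have h3 : c • (W *ᵥ b) = 0 := by
      rw [← mulVec_smul, ← h2, h.transpose.eq, mulVec_mulVec, ← Matrix.mul_assoc,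
        ← Matrix.mul_assoc, hWV]
      simp
    exact (smul_eq_zero.1 h3).resolve_left hc
  have ha : ∀ j, σ j * (Vᵀ *ᵥ b) j = c * (Uᵀ *ᵥ a) j := by
    intro j
    have := congrFun (congrArg (Uᵀ *ᵥ ·) h1) j
    simp only [mulVec_mulVec, hUX, mulVec_smul] at this
    rw [← mulVec_mulVec, mulVec_diagonal] at this
    simpa using this
  have hb : ∀ j, σ j * (Uᵀ *ᵥ a) j = c * (Vᵀ *ᵥ b) j := by
    intro j
    have := congrFun (congrArg (Vᵀ *ᵥ ·) h2) j
    simp only [mulVec_mulVec, hVX, mulVec_smul] at this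
    rw [← mulVec_mulVec, mulVec_diagonal] at this
    simpa using this
  have hUa : U *ᵥ (Uᵀ *ᵥ a) = a := by
    have h3 : c • (U *ᵥ (Uᵀ *ᵥ a)) = c • a := by
      rw [← mulVec_smul, ← mulVec_smul, ← h1, mulVec_mulVec, mulVec_mulVec,
        Matrix.mul_assoc, hUX, ← Matrix.mul_assoc, ← h.eq]
    exact smul_right_injective _ hc h3
  have hd : diagonal (fun i => p * σ i ^ (p - 1)) *ᵥ (Vᵀ *ᵥ b) =
      (p * |c| ^ (p - 2) * c) • (Uᵀ *ᵥ a) := by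
    ext j
    rw [mulVec_diagonal, Pi.smul_apply, smul_eq_mul]
    have hσ : σ j ^ (p - 1) = σ j ^ (p - 2) * σ j := by
      rw [← Real.rpow_add_one (h.pos j).ne']; congr 1; ring
    by_cases h0 : (Uᵀ *ᵥ a) j = 0
    · have hz : σ j * (Vᵀ *ᵥ b) j = 0 := by rw [ha, h0, mul_zero]
      have : (Vᵀ *ᵥ b) j = 0 := (mul_eq_zero.1 hz).resolve_left (h.pos j).ne'
      rw [this, h0]; simp
    · have hsq : σ j ^ 2 = c ^ 2 := by
        refine mul_right_cancel₀ h0 ?_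
        linear_combination σ j * hb j + c * ha j
      have habs : |c| = σ j := by
        rw [← abs_of_pos (h.pos j)]; exact (sq_eq_sq_iff_abs_eq_abs _ _).1 hsq.symm
      rw [habs, hσ]
      linear_combination p * σ j ^ (p - 2) * ha j
  rw [add_mulVec, hW, add_zero, ← mulVec_mulVec, ← mulVec_mulVec, hd, mulVec_smul, hUa]

theorem IsCompactSVD.exists_quadratic_le_schattenPow (h : IsCompactSVD X U σ V) {p : ℝ}
    (hp0 : 0 < p) (hp1 : p < 1) (hUW : Uᵀ * W = 0) (hWV : W * V = 0)
    {Y : Matrix (Fin m) (Fin n) ℝ}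
    (hY : Y = U * diagonal (fun i => p * σ i ^ (p - 1)) * Vᵀ + W) :
    ∃ C, ∀ Z, schattenPow p X + (Yᵀ * (Z - X)).trace - C * ((Z - X)ᵀ * (Z - X)).trace ≤
      schattenPow p Z := by
  obtain ⟨G, μ, hG⟩ := exists_isEigenbasis (transpose_symmDilation X)
  set y := fun i => p * |μ i| ^ (p - 2) * μ i with hy
  set M := Gᵀ * symmDilation Y * G with hM
  have hMsymm : Mᵀ = M := by
    rw [hM, transpose_mul, transpose_mul, transpose_transpose, transpose_symmDilation,
      Matrix.mul_assoc]
  have hcolumn : ∀ i, μ i ≠ 0 → symmDilation Y *ᵥ G.col i = y i • G.col i := by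
    intro i hi
    obtain ⟨h1, h2⟩ := symmDilation_mulVec_eq_iff.1 (hG.mulVec_col i)
    refine symmDilation_mulVec_eq_iff.2 ⟨?_, ?_⟩
    · rw [hY]
      exact h.mulVec_of_singular_pair p hWV hi h1 h2
    · have hYt : Yᵀ = V * diagonal (fun i => p * σ i ^ (p - 1)) * Uᵀ + Wᵀ := by
        rw [hY]; simp [Matrix.mul_assoc]
      rw [hYt]
      refine h.transpose.mulVec_of_singular_pair p ?_ hi h2 (by rwa [transpose_transpose])
      rw [← transpose_transpose U, ← transpose_mul, hUW, transpose_zero]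
  have hMcol : ∀ i j, μ j ≠ 0 → M i j = (diagonal y : Matrix _ _ ℝ) i j := by
    intro i j hj
    have h1 : M i j = (Gᵀ *ᵥ (symmDilation Y *ᵥ G.col j)) i := by
      rw [mulVec_mulVec, hM, mul_apply]; rfl
    have h2 : (Gᵀ *ᵥ G.col j) i = (1 : Matrix _ _ ℝ) i j := by
      rw [← hG.transpose_mul_self, mul_apply]; rfl
    rw [h1, hcolumn j hj, mulVec_smul, Pi.smul_apply, h2, smul_eq_mul, one_apply, diagonal_apply]
    split_ifs with hij
    · rw [hij, mul_one]
    · rw [mul_zero]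
  -- `N` lives on the kernel of the dilation of `X`; its entries determine the slope `w` requested
  -- from the scalar inequality.
  set N := M - diagonal y with hN
  have hN0 : ∀ i j, N i j ≠ 0 → μ i = 0 ∧ μ j = 0 := by
    intro i j hne
    constructor
    · by_contra hi
      refine hne ?_
      have h1 := hMcol j i hi
      rw [← hMsymm, transpose_apply, ← diagonal_transpose, transpose_apply] at h1
      simp [hN, h1]
    · by_contra hj
      exact hne (by simp [hN, hMcol i j hj])
  set w := ∑ i, ∑ j, |N i j| with hw
  choose C hC hle using fun i => exists_quadratic_add_le_abs_rpow hp0 hp1 (μ i) w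
  set K := ∑ i, C i with hK
  have hleK : ∀ i x, |μ i| ^ p + y i * (x - μ i) + (if μ i = 0 then w * |x| else 0) -
      K * (x - μ i) ^ 2 ≤ |x| ^ p := by
    intro i x
    have h1 : C i ≤ K := Finset.single_le_sum (fun j _ => hC j) (Finset.mem_univ i)
    have h2 := mul_le_mul_of_nonneg_right h1 (sq_nonneg (x - μ i))
    have h3 := hle i x
    simp only [hy]
    linarith
  refine ⟨K, fun Z => ?_⟩
  obtain ⟨E, l, hE⟩ := exists_isEigenbasis (transpose_symmDilation Z)
  set O := Gᵀ * E with hO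
  have hGO : G * O = E := by
    rw [hO, ← Matrix.mul_assoc, hG.mul_transpose_self, Matrix.one_mul]
  have hrow : ∀ i, ∑ k, O i k ^ 2 = 1 := by
    intro i
    have h1 : O * Oᵀ = 1 := by
      rw [hO, transpose_mul, transpose_transpose, Matrix.mul_assoc, ← Matrix.mul_assoc E,
        hE.mul_transpose_self, Matrix.one_mul, hG.transpose_mul_self]
    simpa [mul_apply, sq] using congrFun (congrFun h1 i) i
  have hcol : ∀ k, ∑ i, O i k ^ 2 = 1 := by
    intro k
    have h1 : Oᵀ * O = 1 := by
      rw [hO, transpose_mul, transpose_transpose, Matrix.mul_assoc, ← Matrix.mul_assoc G,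
        hG.mul_transpose_self, Matrix.one_mul, hE.transpose_mul_self]
    simpa [mul_apply, sq] using congrFun (congrFun h1 k) k
  set q := fun k => O.col k ⬝ᵥ (N *ᵥ O.col k) with hq
  have htrZ : (symmDilation Y * symmDilation Z).trace =
      ∑ k, l k * (∑ i, O i k ^ 2 * y i + q k) := by
    have h1 : Eᵀ * symmDilation Y * E = Oᵀ * (diagonal y * O) + Oᵀ * (N * O) := by
      have h2 : diagonal y + N = M := by rw [hN]; abel
      rw [← Matrix.mul_add, ← Matrix.add_mul, h2, hM, ← hGO, transpose_mul]
      simp only [Matrix.mul_assoc]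
    rw [hE.eq_mul, ← Matrix.mul_assoc, trace_mul_comm, ← Matrix.mul_assoc, ← Matrix.mul_assoc, h1,
      trace]
    refine Finset.sum_congr rfl fun k _ => ?_
    rw [diag_apply, mul_diagonal, Matrix.add_apply, mul_apply, mul_comm]
    congr 2
    refine Finset.sum_congr rfl fun i _ => ?_
    rw [diagonal_mul, transpose_apply]; ring
  have htrX : (symmDilation Y * symmDilation X).trace = ∑ i, y i * μ i := by
    rw [hG.eq_mul, ← Matrix.mul_assoc, trace_mul_comm, ← Matrix.mul_assoc, ← Matrix.mul_assoc,
      ← hM, trace]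
    refine Finset.sum_congr rfl fun i _ => ?_
    rw [diag_apply, mul_diagonal]
    by_cases hi : μ i = 0
    · simp [hi]
    · rw [hMcol i i hi, diagonal_apply_eq]
  have htrD : (symmDilation (Z - X) * symmDilation (Z - X)).trace =
      ∑ k, ∑ i, O i k ^ 2 * (l k - μ i) ^ 2 := by
    set S := Gᵀ * symmDilation (Z - X) * E with hS
    -- In the mixed bases the difference has entries `O i k * (l k - μ i)`, which makes the
    -- Frobenius error an average of scalar squared errors.
    have h1 : S = O * diagonal l - diagonal μ * O := by
      have h2 : Gᵀ * symmDilation X = diagonal μ * Gᵀ := by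
        rw [hG.eq_mul, ← Matrix.mul_assoc, ← Matrix.mul_assoc, hG.transpose_mul_self,
          Matrix.one_mul]
      rw [hS, symmDilation_sub, Matrix.mul_sub, Matrix.sub_mul, Matrix.mul_assoc, hE.mul_eq, h2,
        hO]
      simp only [Matrix.mul_assoc]
    have h2 : Sᵀ * S = Eᵀ * (symmDilation (Z - X) * symmDilation (Z - X) * E) := by
      rw [hS, transpose_mul, transpose_mul, transpose_transpose, transpose_symmDilation]
      simp only [Matrix.mul_assoc]
      rw [← Matrix.mul_assoc G, hG.mul_transpose_self, Matrix.one_mul]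
    have h3 : (Sᵀ * S).trace = (symmDilation (Z - X) * symmDilation (Z - X)).trace := by
      rw [h2, trace_mul_comm, Matrix.mul_assoc, hE.mul_transpose_self, Matrix.mul_one]
    rw [← h3, trace]
    refine Finset.sum_congr rfl fun k _ => ?_
    rw [diag_apply, mul_apply]
    refine Finset.sum_congr rfl fun i _ => ?_
    rw [transpose_apply, h1, Matrix.sub_apply, mul_diagonal, diagonal_mul]
    ring
  have hk : ∀ k, ∑ i, O i k ^ 2 * |μ i| ^ p + (l k * (∑ i, O i k ^ 2 * y i + q k) -
      ∑ i, O i k ^ 2 * (y i * μ i)) - K * ∑ i, O i k ^ 2 * (l k - μ i) ^ 2 ≤ |l k| ^ p := by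
    intro k
    -- The kernel block is paid for by the extra `w * |l k|` terms at the indices with `μ i = 0`.
    have h1 : l k * q k ≤ ∑ i, O i k ^ 2 * (if μ i = 0 then w * |l k| else 0) := by
      calc l k * q k ≤ |l k| * |q k| := by rw [← abs_mul]; exact le_abs_self _
        _ ≤ |l k| * (w * ∑ i, if μ i = 0 then O i k ^ 2 else 0) :=
            mul_le_mul_of_nonneg_left (abs_dotProduct_mulVec_le hN0 _) (abs_nonneg _)
        _ = _ := by
            rw [Finset.mul_sum, Finset.mul_sum]
            refine Finset.sum_congr rfl fun i _ => ?_
            split_ifs <;> ring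
    have h2 : ∑ i, O i k ^ 2 * (|μ i| ^ p + y i * (l k - μ i) +
        (if μ i = 0 then w * |l k| else 0) - K * (l k - μ i) ^ 2) ≤ |l k| ^ p := by
      calc _ ≤ ∑ i, O i k ^ 2 * |l k| ^ p :=
            Finset.sum_le_sum fun i _ => mul_le_mul_of_nonneg_left (hleK i (l k)) (sq_nonneg _)
        _ = |l k| ^ p := by rw [← Finset.sum_mul, hcol k, one_mul]
    have h3 : ∑ i, O i k ^ 2 * (|μ i| ^ p + y i * (l k - μ i) +
        (if μ i = 0 then w * |l k| else 0) - K * (l k - μ i) ^ 2) =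
        ∑ i, O i k ^ 2 * |μ i| ^ p + (l k * ∑ i, O i k ^ 2 * y i -
          ∑ i, O i k ^ 2 * (y i * μ i)) + ∑ i, O i k ^ 2 * (if μ i = 0 then w * |l k| else 0) -
          K * ∑ i, O i k ^ 2 * (l k - μ i) ^ 2 := by
      simp only [Finset.mul_sum, ← Finset.sum_add_distrib, ← Finset.sum_sub_distrib]
      exact Finset.sum_congr rfl fun i _ => by ring
    rw [h3] at h2
    linarith
  have hsum := Finset.sum_le_sum fun k (_ : k ∈ Finset.univ) => hk k
  have hswap : ∀ c : Fin m ⊕ Fin n → ℝ, ∑ k, ∑ i, O i k ^ 2 * c i = ∑ i, c i := by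
    intro c
    rw [Finset.sum_comm]
    exact Finset.sum_congr rfl fun i _ => by rw [← Finset.sum_mul, hrow i, one_mul]
  rw [Finset.sum_sub_distrib, Finset.sum_add_distrib, Finset.sum_sub_distrib, ← Finset.mul_sum,
    hswap, hswap, ← htrZ, ← htrX, ← htrD, ← hE.two_mul_schattenPow hp0,
    ← hG.two_mul_schattenPow hp0] at hsum
  simp only [trace_symmDilation_mul] at hsum
  rw [Matrix.mul_sub, trace_sub]
  linarith

end LowerBound

/-! ### Directional tests, for necessity. -/

section UpperBound

open Matrix

variable {m n r : ℕ} {X Y : Matrix (Fin m) (Fin n) ℝ} {U : Matrix (Fin m) (Fin r) ℝ}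
  {σ : EuclideanSpace ℝ (Fin r)} {V : Matrix (Fin n) (Fin r) ℝ}

theorem inner_matrix_eq (A B : Matrix (Fin m) (Fin n) ℝ) : inner ℝ A B = (Aᵀ * B).trace := rfl

theorem IsCompactSVD.mul_right_of_mem_regularSubdifferential (h : IsCompactSVD X U σ V) {p : ℝ}
    (hp0 : 0 < p) (hp1 : p < 1) (hY : Y ∈ regularSubdifferential (schattenPow p) X) :
    Y * V = U * diagonal (fun i => p * σ i ^ (p - 1)) := by
  have key : ∀ K : Matrix (Fin m) (Fin r) ℝ, inner ℝ Y (K * Vᵀ) =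
      ∑ i, (p * σ i ^ (p - 1)) * (Uᵀ * K) i i := by
    intro K
    -- The base of each power is the squared norm of column `i` of `U * diagonal σ + t • K`. It
    -- equals `σ i ^ 2 > 0` at `t = 0`, so the power is differentiable there.
    refine inner_eq_of_mem_regularSubdifferential (φ := fun t => ∑ i,
      (σ i ^ 2 + 2 * t * (σ i * (Uᵀ * K) i i) + t ^ 2 * (Kᵀ * K) i i) ^ (p / 2)) hY ?_ ?_ ?_
    · refine HasDerivAt.fun_sum fun i _ => ?_
      have hpoly : HasDerivAt
          (fun t : ℝ => σ i ^ 2 + 2 * t * (σ i * (Uᵀ * K) i i) + t ^ 2 * (Kᵀ * K) i i)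
          (2 * (σ i * (Uᵀ * K) i i)) 0 := by
        have h1 := (((hasDerivAt_id (0 : ℝ)).const_mul 2).mul_const (σ i * (Uᵀ * K) i i)).const_add
          (σ i ^ 2)
        have h2 := ((hasDerivAt_id (0 : ℝ)).pow 2).mul_const ((Kᵀ * K) i i)
        refine (h1.fun_add h2).congr_deriv ?_
        simp
      have hσ := h.pos i
      have := hpoly.rpow_const (p := p / 2) (Or.inl (by simpa using hσ.ne'))
      refine this.congr_deriv ?_
      have h1 : (σ i ^ 2) ^ (p / 2 - 1) = σ i ^ (p - 2) := by
        rw [← Real.rpow_natCast, ← Real.rpow_mul hσ.le]; congr 1; push_cast; ring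
      have h2 : σ i ^ (p - 1) = σ i ^ (p - 2) * σ i := by
        rw [← Real.rpow_add_one hσ.ne']; congr 1; ring
      simp only [mul_zero, zero_mul, add_zero, ne_eq, OfNat.ofNat_ne_zero, not_false_eq_true,
        zero_pow, h1, h2]
      ring
    · rw [h.schattenPow_eq hp0]
      refine Finset.sum_congr rfl fun i _ => ?_
      simp only [mul_zero, zero_mul, add_zero, ne_eq, OfNat.ofNat_ne_zero, not_false_eq_true,
        zero_pow]
      rw [← Real.rpow_natCast, ← Real.rpow_mul (h.pos i).le]; congr 1; push_cast; ring
    · intro t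
      have hZV : (X + t • (K * Vᵀ)) * V = U * diagonal (fun i => σ i) + t • K := by
        rw [Matrix.add_mul, h.mul_right, smul_mul, Matrix.mul_assoc, h.orthonormal_right,
          Matrix.mul_one]
      refine (schattenPow_le_of_mul_eq hp0 hp1 h.orthonormal_right ?_).trans (le_of_eq ?_)
      · rw [hZV, Matrix.add_mul, ← h.eq, smul_mul]
      · refine Finset.sum_congr rfl fun i _ => ?_
        congr 1
        have hUU : (U * diagonal (fun i => σ i))ᵀ * (U * diagonal (fun i => σ i)) =
            diagonal (fun i => σ i ^ 2) := by
          rw [transpose_mul, Matrix.mul_assoc, ← Matrix.mul_assoc Uᵀ, h.orthonormal_left,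
            Matrix.one_mul, diagonal_transpose, diagonal_mul_diagonal]
          simp only [sq]
        have hUK : ((U * diagonal (fun i => σ i))ᵀ * K) i i = σ i * (Uᵀ * K) i i := by
          rw [transpose_mul, Matrix.mul_assoc, diagonal_transpose, diagonal_mul]
        have hKU : (Kᵀ * (U * diagonal (fun i => σ i))) i i = σ i * (Uᵀ * K) i i := by
          rw [← hUK, ← transpose_apply (Kᵀ * _), transpose_mul, transpose_transpose]
        rw [hZV, transpose_add, Matrix.add_mul, Matrix.mul_add, Matrix.mul_add, hUU,
          transpose_smul, smul_mul, smul_mul, Matrix.mul_smul,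
          Matrix.mul_smul]
        simp only [Matrix.add_apply, Matrix.smul_apply, smul_eq_mul, hUK, hKU, diagonal_apply_eq]
        ring
  ext a i
  -- Testing with matrix units reads off the entries of `Y * V`.
  have h1 := key (Matrix.single a i 1)
  rw [inner_matrix_eq, ← Matrix.mul_assoc, trace_mul_comm, ← Matrix.mul_assoc, ← transpose_mul,
    trace_mul_single, transpose_apply] at h1
  rw [mul_diagonal]
  have h2 : ∀ j, (Uᵀ * Matrix.single a i (1 : ℝ)) j j = if j = i then U a j else 0 := by
    intro j
    by_cases hj : j = i
    · subst hj; simp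
    · simp [hj, Matrix.mul_single_apply_of_ne]
  simp only [h2] at h1
  simpa [mul_comm] using h1

theorem transpose_mem_regularSubdifferential {p : ℝ} (hp : 0 < p)
    (hY : Y ∈ regularSubdifferential (schattenPow p) X) :
    Yᵀ ∈ regularSubdifferential (schattenPow p) Xᵀ := by
  intro ε hε
  have hc : Tendsto (fun Z : Matrix (Fin n) (Fin m) ℝ => Zᵀ) (𝓝 Xᵀ) (𝓝 X) := by
    have : Continuous fun Z : Matrix (Fin n) (Fin m) ℝ => Zᵀ := by fun_prop
    simpa using this.tendsto Xᵀ
  filter_upwards [hc.eventually (hY ε hε)] with Z hZ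
  have h1 : inner ℝ Yᵀ (Z - Xᵀ) = inner ℝ Y (Zᵀ - X) := by
    rw [inner_matrix_eq, inner_matrix_eq, ← trace_transpose (Yᵀ * (Zᵀ - X)), transpose_mul,
      transpose_transpose, transpose_sub, transpose_transpose, trace_mul_comm]
  have h2 : ‖Z - Xᵀ‖ = ‖Zᵀ - X‖ := by
    rw [← frobenius_norm_transpose, transpose_sub, transpose_transpose]
  rw [schattenPow_transpose hp, h1, h2, ← schattenPow_transpose hp Z]
  exact hZ

end UpperBound

theorem lemma1 {m n r : ℕ} (p : ℝ) (hp0 : 0 < p) (hp1 : p < 1)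
    (X : Matrix (Fin m) (Fin n) ℝ)
    (U : Matrix (Fin m) (Fin r) ℝ) (σ : EuclideanSpace ℝ (Fin r))
    (V : Matrix (Fin n) (Fin r) ℝ) (hX : IsCompactSVD X U σ V) :
    regularSubdifferential (schattenPow p) X =
      {Y : Matrix (Fin m) (Fin n) ℝ |
        ∃ d ∈ regularSubdifferential (lpPow p) σ, ∃ W : Matrix (Fin m) (Fin n) ℝ,
          U.transpose * W = 0 ∧ W * V = 0 ∧
          Y = U * Matrix.diagonal (fun i => d i) * V.transpose + W} := by
  ext Y
  constructor
  · intro hY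
    have hR := hX.mul_right_of_mem_regularSubdifferential hp0 hp1 hY
    have hL := hX.transpose.mul_right_of_mem_regularSubdifferential hp0 hp1
      (transpose_mem_regularSubdifferential hp0 hY)
    have hL' : U.transpose * Y =
        Matrix.diagonal (fun i => p * σ i ^ (p - 1)) * V.transpose := by
      have := congrArg Matrix.transpose hL
      simpa using this
    refine ⟨WithLp.toLp 2 fun i => p * σ i ^ (p - 1),
      (mem_regularSubdifferential_lpPow_iff hp0 hp1 hX.pos _).2 fun i => rfl,
      Y - U * Matrix.diagonal (fun i => p * σ i ^ (p - 1)) * V.transpose, ?_, ?_, ?_⟩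
    · rw [Matrix.mul_sub, hL', ← Matrix.mul_assoc, ← Matrix.mul_assoc, hX.orthonormal_left,
        Matrix.one_mul, sub_self]
    · rw [Matrix.sub_mul, hR, Matrix.mul_assoc, hX.orthonormal_right, Matrix.mul_one, sub_self]
    · simp
  · rintro ⟨d, hd, W, hUW, hWV, hY⟩
    have hd' := (mem_regularSubdifferential_lpPow_iff hp0 hp1 hX.pos d).1 hd
    simp only [hd'] at hY
    obtain ⟨C, hC⟩ := hX.exists_quadratic_le_schattenPow hp0 hp1 hUW hWV hY
    refine mem_regularSubdifferential_of_quadratic C fun Z => ?_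
    rw [← real_inner_self_eq_norm_sq]
    exact hC Z
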